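/- Let $M, N, k$ be integers with $1 \le M < N$ and $0 \le k \le N$. Let $\mathrm{Gr}(M,N)$ be the space of $N\times N$ complex Hermitian idempotent matrices $S$ of rank $M$, with the normalised $U(N)$-invariant measure $\mathrm{d}S$ induced by the Haar measure of $U(N)$ through $U \mapsto U I_{M,N} U^*$, where $I_{M,N}$ is the $N\times N$ diagonal matrix whose first $M$ diagonal entries are $1$ and whose other entries are $0$. For a permutation $\sigma \in S_k$ define the Weingarten function \[ W(\sigma) = \int_{\mathrm{Gr}(M,N)} S_{1,\sigma(1)} S_{2,\sigma(2)} \cdots S_{k,\sigma(k)} \, \mathrm{d}S . \] A monotone factorisation of $\sigma$ of length $r$ is a sequence $\tau = (\tau_1, \ldots, \tau_r)$ of transpositions $\tau_i = (a_i~b_i)$ in $S_k$, where $a_i < b_i$, such that $\tau_1 \tau_2 \cdots \tau_r = \sigma$ (permutations are composed from right to left) and $b_1 \le b_2 \le \cdots \le b_r$. Its hive number is the number $|\{b_1, \ldots, b_r\}|$ of distinct values among the $b_i$. Let $h^t_r(\sigma) = \sum_{\tau} t^{|\{b_1, \ldots, b_r\}|}$, where the sum is over the monotone factorisations $\tau$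 of $\sigma$ of length $r$. Then, with $t = 1 - \frac{N}{M}$, the following series converges and \[ W(\sigma) = \frac{1}{(1-t)^k} \sum_{r=0}^\infty h^t_r(\sigma) \left( -\frac{1}{N} \right)^r . \] -/

import Mathlib

open MeasureTheory

namespace GrassmannWeingarten

/-- The matrix `I_{M,N}`: the `N × N` diagonal matrix whose first `M` diagonal entries are `1` and
whose remaining entries are `0`. -/
def truncatedIdentity (M N : ℕ) : Matrix (Fin N) (Fin N) ℂ :=
  Matrix.diagonal fun i => if (i : ℕ) < M then 1 else 0

/-- The complex Grassmannian `Gr(M,N)`, as the space of `N × N` idempotent Hermitian complex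
matrices of rank `M`. -/
def grassmannian (M N : ℕ) : Set (Matrix (Fin N) (Fin N) ℂ) :=
  {S | S * S = S ∧ S.IsHermitian ∧ S.rank = M}

/-- The unitary conjugates of `I_{M,N}` belong to the Grassmannian. -/
theorem conj_mem_grassmannian {M N : ℕ} (hMN : M < N) (U : Matrix.unitaryGroup (Fin N) ℂ) :
    (U : Matrix (Fin N) (Fin N) ℂ) * truncatedIdentity M N *
      (U : Matrix (Fin N) (Fin N) ℂ).conjTranspose ∈ grassmannian M N := by
  have hU : (U : Matrix (Fin N) (Fin N) ℂ).conjTranspose * (U : Matrix (Fin N) (Fin N) ℂ) = 1 :=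
    Matrix.mem_unitaryGroup_iff'.1 U.2
  have hU' : (U : Matrix (Fin N) (Fin N) ℂ) * (U : Matrix (Fin N) (Fin N) ℂ).conjTranspose = 1 :=
    Matrix.mem_unitaryGroup_iff.1 U.2
  have hdet : IsUnit (U : Matrix (Fin N) (Fin N) ℂ).det :=
    (Matrix.isUnit_iff_isUnit_det _).1 (IsUnit.of_mul_eq_one _ hU')
  have hdet' : IsUnit (U : Matrix (Fin N) (Fin N) ℂ).conjTranspose.det :=
    (Matrix.isUnit_iff_isUnit_det _).1 (IsUnit.of_mul_eq_one _ hU)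
  have hT : truncatedIdentity M N * truncatedIdentity M N = truncatedIdentity M N := by
    simp [truncatedIdentity]
  refine ⟨?_, ?_, ?_⟩
  · calc (U : Matrix (Fin N) (Fin N) ℂ) * truncatedIdentity M N *
          (U : Matrix (Fin N) (Fin N) ℂ).conjTranspose *
          ((U : Matrix (Fin N) (Fin N) ℂ) * truncatedIdentity M N *
          (U : Matrix (Fin N) (Fin N) ℂ).conjTranspose)
        = (U : Matrix (Fin N) (Fin N) ℂ) * (truncatedIdentity M N *
          ((U : Matrix (Fin N) (Fin N) ℂ).conjTranspose * (U : Matrix (Fin N) (Fin N) ℂ)) *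
          truncatedIdentity M N) * (U : Matrix (Fin N) (Fin N) ℂ).conjTranspose := by
          simp only [Matrix.mul_assoc]
      _ = _ := by rw [hU, Matrix.mul_one, hT]
  · apply Matrix.isHermitian_mul_mul_conjTranspose
    rw [truncatedIdentity, Matrix.isHermitian_diagonal_iff]
    intro i
    split_ifs <;> simp
  · rw [Matrix.rank_mul_eq_left_of_isUnit_det _ _ hdet',
      Matrix.rank_mul_eq_right_of_isUnit_det _ _ hdet, truncatedIdentity, Matrix.rank_diagonal]
    have h := Fintype.card_congr (Equiv.subtypeEquivRight
      (p := fun i : Fin N => (if (i : ℕ) < M then (1 : ℂ) else 0) ≠ 0)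
      (q := fun i : Fin N => (i : ℕ) < M) (fun i => by simp))
    rw [h, Fintype.card_subtype]
    have := Fin.card_filter_val_lt (n := N) (m := M)
    simpa [hMN.le] using this

/-- The Borel σ-algebra on the unitary group `U(N)`. -/
noncomputable instance unitaryGroupMeasurableSpace (N : ℕ) :
    MeasurableSpace (Matrix.unitaryGroup (Fin N) ℂ) := borel _

instance unitaryGroupBorelSpace (N : ℕ) : BorelSpace (Matrix.unitaryGroup (Fin N) ℂ) := ⟨rfl⟩

/-- The unitary group `U(N)` is compact. -/
instance unitaryGroupCompactSpace (N : ℕ) : CompactSpace (Matrix.unitaryGroup (Fin N) ℂ) := by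
  suffices h : IsCompact ((Matrix.unitaryGroup (Fin N) ℂ : Submonoid (Matrix (Fin N) (Fin N) ℂ)) :
      Set (Matrix (Fin N) (Fin N) ℂ)) from isCompact_iff_compactSpace.1 h
  have hK : IsCompact {A : Matrix (Fin N) (Fin N) ℂ | ∀ i j, A i j ∈ Metric.closedBall (0 : ℂ) 1} := by
    have h := isCompact_univ_pi (X := fun _ : Fin N => Fin N → ℂ) (fun _ : Fin N =>
      isCompact_univ_pi (X := fun _ : Fin N => ℂ) (fun _ : Fin N =>
        isCompact_closedBall (0 : ℂ) 1))
    have e : {A : Matrix (Fin N) (Fin N) ℂ | ∀ i j, A i j ∈ Metric.closedBall (0 : ℂ) 1} =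
      Set.pi Set.univ (fun _ : Fin N => Set.pi Set.univ
        (fun _ : Fin N => Metric.closedBall (0 : ℂ) 1)) := by
      ext A
      exact ⟨fun hA i _ j _ => hA i j, fun hA i j => hA i trivial j trivial⟩
    rw [e]
    exact h
  refine hK.of_isClosed_subset ?_ ?_
  · have : ((Matrix.unitaryGroup (Fin N) ℂ : Submonoid (Matrix (Fin N) (Fin N) ℂ)) :
        Set (Matrix (Fin N) (Fin N) ℂ)) = {A | A * star A = 1} := by
      ext A
      exact Matrix.mem_unitaryGroup_iff
    rw [this]
    exact isClosed_eq (continuous_id.mul continuous_star) continuous_const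
  · intro A hA i j
    rw [mem_closedBall_zero_iff]
    exact entry_norm_bound_of_unitary hA i j

/-- The normalised Haar measure on the unitary group `U(N)`. -/
noncomputable def unitaryHaar (N : ℕ) : Measure (Matrix.unitaryGroup (Fin N) ℂ) :=
  Measure.haarMeasure ⊤

/-- The Borel σ-algebra on the Grassmannian. -/
noncomputable instance grassmannianMeasurableSpace (M N : ℕ) : MeasurableSpace (grassmannian M N) := borel _

instance grassmannianBorelSpace (M N : ℕ) : BorelSpace (grassmannian M N) := ⟨rfl⟩

/-- The orbit map `U(N) → Gr(M,N)`, `U ↦ U I_{M,N} U*`. -/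
def orbitMap {M N : ℕ} (hMN : M < N) (U : Matrix.unitaryGroup (Fin N) ℂ) : grassmannian M N :=
  ⟨_, conj_mem_grassmannian hMN U⟩

theorem measurable_orbitMap {M N : ℕ} (hMN : M < N) : Measurable (orbitMap hMN) := by
  have : Continuous (orbitMap hMN) := by
    refine Continuous.subtype_mk ?_ _
    exact (continuous_subtype_val.mul continuous_const).mul continuous_subtype_val.star
  exact this.measurable

/-- The normalised `U(N)`-invariant measure `dS` on the Grassmannian, induced by the Haar measure
on `U(N)` through the orbit map. -/
noncomputable def grassmannianMeasure {M N : ℕ} (hMN : M < N) : Measure (grassmannian M N) :=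
  (unitaryHaar N).map (orbitMap hMN)

/-- The measure `dS` is normalised. -/
instance grassmannianMeasure_isProbabilityMeasure {M N : ℕ} (hMN : M < N) :
    IsProbabilityMeasure (grassmannianMeasure hMN) := by
  have : IsProbabilityMeasure (unitaryHaar N) := ⟨by
    rw [unitaryHaar, ← TopologicalSpace.PositiveCompacts.coe_top]
    exact Measure.haarMeasure_self⟩
  exact Measure.isProbabilityMeasure_map (measurable_orbitMap hMN).aemeasurable

/-- The Weingarten function of `Gr(M,N)`: for `σ ∈ S_k` with `k ≤ N`, the integral of
`S_{1,σ(1)} ⋯ S_{k,σ(k)}` against `dS`. -/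
noncomputable def weingarten {M N k : ℕ} (hMN : M < N) (hkN : k ≤ N)
    (σ : Equiv.Perm (Fin k)) : ℂ :=
  ∫ S : grassmannian M N, ∏ i : Fin k,
    (S : Matrix (Fin N) (Fin N) ℂ) (Fin.castLE hkN i) (Fin.castLE hkN (σ i))
    ∂(grassmannianMeasure hMN)

/-- The larger of the two points moved by a transposition: `b` for the transposition `(a b)` with
`a < b`. (The value `⊥` occurs only for the identity, which is not a transposition.) -/
def upperPoint {k : ℕ} (τ : Equiv.Perm (Fin k)) : WithBot (Fin k) := τ.support.max

theorem upperPoint_swap {k : ℕ} {a b : Fin k} (hab : a < b) :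
    upperPoint (Equiv.swap a b) = b := by
  rw [upperPoint, Equiv.Perm.support_swap hab.ne]
  simp [Finset.max_insert, hab.le]

/-- `τ = (τ_1, …, τ_r)` is a monotone factorisation of `σ`: every `τ_i = (a_i b_i)` is a
transposition, where `a_i < b_i`, the product `τ_1 ⋯ τ_r` is `σ` (permutations are composed from
right to left), and `b_1 ≤ ⋯ ≤ b_r`. -/
def IsMonotoneFactorisation {k r : ℕ} (σ : Equiv.Perm (Fin k))
    (τ : Fin r → Equiv.Perm (Fin k)) : Prop :=
  (∀ i, (τ i).IsSwap) ∧ (List.ofFn τ).prod = σ ∧ Monotone fun i => upperPoint (τ i)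

/-- The hive number: the number of distinct elements among `b_1, …, b_r`. -/
def hiveNumber {k r : ℕ} (τ : Fin r → Equiv.Perm (Fin k)) : ℕ :=
  (Finset.univ.image fun i => upperPoint (τ i)).card

open scoped Classical in
/-- The number of monotone factorisations of `σ` into `r` transpositions, each weighted by `t` to
the power of its hive number. -/
noncomputable def weightedCount {k : ℕ} (t : ℂ) (r : ℕ) (σ : Equiv.Perm (Fin k)) : ℂ :=
  ∑ τ : Fin r → Equiv.Perm (Fin k) with IsMonotoneFactorisation σ τ, t ^ hiveNumber τ

end GrassmannWeingarten

/-! Number the points from 0 and let the Jucys–Murphy operator `J_b` send a function `f` on `S_k` to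
`σ ↦ ∑_{l<b} f(σ (l b))`. Let `W_m` be the Weingarten function of permutations of the first `m`
points, extended by zero.

Infinitesimal unitary invariance of the measure gives a loop equation for the moments of `S`.
Summing it over all `N` values of the index at `b`, and using `S² = S` and `tr S = M`, yields `(N +
J_b) W_{b+1} = (M + J_b) W_b` (`prefixWeingarten_recursion`), with `W_0` the indicator of the
identity.

On the combinatorial side, let `F_m(z)` be the generating series of monotone factorisations with all
upper points below `m`. Removing the last transposition gives `(1 - z J_b) F_{b+1} = (1 - (1-t) z
J_b) F_b` (`boundedCount_recursion`, `tsum_boundedCount_recursion`). The quotient of the two factors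
is `1 + t (z J_b + z² J_b² + ⋯)`: one `t` for each value `b` that is used.

At `z = -1/N` and `1 - t = N/M` the two recursions agree up to a factor `M/N` per step, so `W_m =
(M/N)^m F_m`. As `J_b` is a sum of `b < N` translations, the series converges and `1 - z J_b` is
injective, so the recursion determines `W_{b+1}`. -/

namespace GrassmannWeingarten

/-! ### Infinitesimal unitary invariance and the loop equation. -/

section

section OneParameter

open scoped Matrix.Norms.L2Operator

/-- A skew-Hermitian matrix generates a one-parameter family of unitary matrices. -/
theorem exists_unitary_flow {N : ℕ} (X : Matrix (Fin N) (Fin N) ℂ) (hX : X.conjTranspose = -X) :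
    ∃ φ : ℝ → Matrix.unitaryGroup (Fin N) ℂ, φ 0 = 1 ∧
      ∀ (i j : Fin N) (x : ℝ), HasDerivAt (fun y => (φ y : Matrix (Fin N) (Fin N) ℂ) i j)
        ((X * (φ x : Matrix (Fin N) (Fin N) ℂ)) i j) x := by
  have hmem : ∀ y : ℝ, NormedSpace.exp (y • X) ∈ Matrix.unitaryGroup (Fin N) ℂ := by
    intro y
    let : NormedAlgebra ℚ (Matrix (Fin N) (Fin N) ℂ) := NormedAlgebra.restrictScalars ℚ ℝ _
    refine NormedSpace.exp_mem_unitary_of_mem_skewAdjoint ?_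
    rw [skewAdjoint.mem_iff, Matrix.star_eq_conjTranspose, Matrix.conjTranspose_smul, hX]
    simp
  refine ⟨fun y => ⟨_, hmem y⟩, ?_, fun i j x => ?_⟩
  · ext1
    simp
  · have h := hasDerivAt_exp_smul_const' (𝕂 := ℝ) X x
    let L : Matrix (Fin N) (Fin N) ℂ →L[ℝ] ℂ :=
      LinearMap.toContinuousLinearMap (Matrix.entryLinearMap ℝ ℂ i j)
    exact (L.hasFDerivAt.comp_hasDerivAt x h :)

end OneParameter

variable {N : ℕ}

instance unitaryHaar_isProbabilityMeasure (N : ℕ) : IsProbabilityMeasure (unitaryHaar N) := ⟨by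
  rw [unitaryHaar, ← TopologicalSpace.PositiveCompacts.coe_top]
  exact Measure.haarMeasure_self⟩

instance unitaryHaar_isMulLeftInvariant (N : ℕ) : (unitaryHaar N).IsMulLeftInvariant := by
  unfold unitaryHaar; infer_instance

/-- The projection `U I_{M,N} U*`. -/
noncomputable def projection (M : ℕ) (U : Matrix.unitaryGroup (Fin N) ℂ) :
    Matrix (Fin N) (Fin N) ℂ :=
  (U : Matrix (Fin N) (Fin N) ℂ) * truncatedIdentity M N *
    (U : Matrix (Fin N) (Fin N) ℂ).conjTranspose

theorem continuous_projection (M : ℕ) : Continuous (projection (N := N) M) :=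
  (continuous_subtype_val.mul continuous_const).mul continuous_subtype_val.star

@[fun_prop]
theorem continuous_projection_apply (M : ℕ) (i j : Fin N) :
    Continuous fun U => projection M U i j :=
  (continuous_projection M).matrix_elem i j

theorem projection_mul (M : ℕ) (V U : Matrix.unitaryGroup (Fin N) ℂ) :
    projection M (V * U) = (V : Matrix (Fin N) (Fin N) ℂ) * projection M U *
      (V : Matrix (Fin N) (Fin N) ℂ).conjTranspose := by
  simp [projection, Matrix.mul_assoc]

theorem integrable_of_continuous {f : Matrix.unitaryGroup (Fin N) ℂ → ℂ} (hf : Continuous f) :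
    Integrable f (unitaryHaar N) :=
  hf.integrable_of_hasCompactSupport (HasCompactSupport.of_compactSpace f)

/-- The matrix entries of the projection move by the commutator with `X` along the flow of `X`. -/
theorem hasDerivAt_projection_flow (M : ℕ) {X : Matrix (Fin N) (Fin N) ℂ}
    (hX : X.conjTranspose = -X) {φ : ℝ → Matrix.unitaryGroup (Fin N) ℂ}
    (hφ : ∀ (i j : Fin N) (x : ℝ), HasDerivAt (fun y => (φ y : Matrix (Fin N) (Fin N) ℂ) i j)
        ((X * (φ x : Matrix (Fin N) (Fin N) ℂ)) i j) x)
    (U : Matrix.unitaryGroup (Fin N) ℂ) (i j : Fin N) (x : ℝ) :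
    HasDerivAt (fun y => projection M (φ y * U) i j)
      ((X * projection M (φ x * U) - projection M (φ x * U) * X) i j) x := by
  have key : X * projection M (φ x * U) - projection M (φ x * U) * X =
      (X * (φ x : Matrix (Fin N) (Fin N) ℂ)) * projection M U *
        (φ x : Matrix (Fin N) (Fin N) ℂ).conjTranspose +
      (φ x : Matrix (Fin N) (Fin N) ℂ) * projection M U *
        (X * (φ x : Matrix (Fin N) (Fin N) ℂ)).conjTranspose := by
    rw [Matrix.conjTranspose_mul, hX, projection_mul]
    simp [Matrix.mul_assoc, sub_eq_add_neg]
  rw [key]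
  simp only [projection_mul]
  simp only [Matrix.mul_apply (M := _ * projection M U), Matrix.mul_apply (N := projection M U),
    Matrix.add_apply, ← Finset.sum_add_distrib]
  refine HasDerivAt.fun_sum fun a _ => ?_
  refine HasDerivAt.fun_mul (HasDerivAt.fun_sum fun b _ => (hφ i b x).mul_const _) ?_
  simp only [Matrix.conjTranspose_apply]
  exact (hφ j a x).star

theorem integrable_prod_projection {ι : Type*} (M : ℕ) (s : Finset ι) (r c : ι → Fin N) :
    Integrable (fun U => ∏ i ∈ s, projection M U (r i) (c i)) (unitaryHaar N) :=
  integrable_of_continuous (by fun_prop)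

variable {ι : Type*} [DecidableEq ι]

/-- Mixed moments of the entries of a random projection. -/
noncomputable def moment (M : ℕ) (s : Finset ι) (r c : ι → Fin N) : ℂ :=
  ∫ U, ∏ i ∈ s, projection M U (r i) (c i) ∂(unitaryHaar N)

/-- The derivative of a product of entries in the direction of the commutator with `X`. -/
noncomputable def commutatorDeriv (s : Finset ι) (r c : ι → Fin N)
    (X P : Matrix (Fin N) (Fin N) ℂ) : ℂ :=
  ∑ l ∈ s, (∏ j ∈ s.erase l, P (r j) (c j)) * (X * P - P * X) (r l) (c l)

theorem continuous_commutatorDeriv (M : ℕ) (s : Finset ι) (r c : ι → Fin N)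
    (X : Matrix (Fin N) (Fin N) ℂ) :
    Continuous fun U => commutatorDeriv s r c X (projection M U) := by
  unfold commutatorDeriv
  simp only [Matrix.sub_apply, Matrix.mul_apply]
  fun_prop

/-- The moment is unchanged when `U` is replaced by `φ y * U`, by left invariance of Haar measure.
Differentiating under the integral at `y = 0` gives the claim. -/
theorem integral_commutatorDeriv_of_skew (M : ℕ) (s : Finset ι) (r c : ι → Fin N)
    {X : Matrix (Fin N) (Fin N) ℂ} (hX : X.conjTranspose = -X) :
    ∫ U, commutatorDeriv s r c X (projection M U) ∂(unitaryHaar N) = 0 := by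
  obtain ⟨φ, hφ0, hφ⟩ := exists_unitary_flow X hX
  have hcont := continuous_commutatorDeriv M s r c X
  -- Compactness of `U(N)` bounds the derivative uniformly in `y` and `U`, so a constant serves as
  -- dominating function.
  obtain ⟨C, hC⟩ := isCompact_univ.exists_bound_of_continuousOn hcont.continuousOn
  have hprod : ∀ V : Matrix.unitaryGroup (Fin N) ℂ,
      Continuous fun U => ∏ i ∈ s, projection M (V * U) (r i) (c i) := by
    intro V
    refine continuous_finsetProd _ fun i _ => ?_
    exact (continuous_projection_apply M (r i) (c i)).comp (continuous_const.mul continuous_id)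
  have h := (hasDerivAt_integral_of_dominated_loc_of_deriv_le (μ := unitaryHaar N) (x₀ := (0 : ℝ))
    (s := Set.univ) (bound := fun _ => C)
    (F := fun y U => ∏ i ∈ s, projection M (φ y * U) (r i) (c i))
    (F' := fun y U => commutatorDeriv s r c X (projection M (φ y * U))) Filter.univ_mem
    (Filter.Eventually.of_forall fun y => (integrable_of_continuous (hprod _)).aestronglyMeasurable)
    (integrable_of_continuous (hprod _))
    (integrable_of_continuous
      (hcont.comp (continuous_const.mul continuous_id))).aestronglyMeasurable
    (Filter.Eventually.of_forall fun U y _ => hC _ trivial)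
    (integrable_const C)
    (Filter.Eventually.of_forall fun U y _ => ?_)).2
  · have hconst : (fun y : ℝ => ∫ U, ∏ i ∈ s, projection M (φ y * U) (r i) (c i) ∂(unitaryHaar N)) =
        fun _ => moment M s r c := by
      funext y
      exact integral_mul_left_eq_self (μ := unitaryHaar N)
        (fun U => ∏ i ∈ s, projection M U (r i) (c i)) (φ y)
    rw [hconst] at h
    have := h.unique (hasDerivAt_const _ _)
    simpa [hφ0] using this
  · have := HasDerivAt.fun_finsetProd (u := s) fun i _ =>
      hasDerivAt_projection_flow M hX hφ U (r i) (c i) y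
    simpa only [smul_eq_mul, commutatorDeriv] using this

theorem commutatorDeriv_add (s : Finset ι) (r c : ι → Fin N)
    (X Y P : Matrix (Fin N) (Fin N) ℂ) :
    commutatorDeriv s r c (X + Y) P = commutatorDeriv s r c X P + commutatorDeriv s r c Y P := by
  simp only [commutatorDeriv, ← Finset.sum_add_distrib, Matrix.sub_apply,
    Matrix.add_mul, Matrix.mul_add, Matrix.add_apply]
  refine Finset.sum_congr rfl fun l _ => ?_
  ring

theorem commutatorDeriv_smul (s : Finset ι) (r c : ι → Fin N) (z : ℂ)
    (X P : Matrix (Fin N) (Fin N) ℂ) :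
    commutatorDeriv s r c (z • X) P = z * commutatorDeriv s r c X P := by
  simp only [commutatorDeriv, Finset.mul_sum, Matrix.sub_apply,
    Matrix.smul_mul, Matrix.mul_smul, Matrix.smul_apply, smul_eq_mul]
  refine Finset.sum_congr rfl fun l _ => ?_
  ring

/-- Infinitesimal unitary invariance, complexified to all matrices `X`. -/
theorem integral_commutatorDeriv (M : ℕ) (s : Finset ι) (r c : ι → Fin N)
    (X : Matrix (Fin N) (Fin N) ℂ) :
    ∫ U, commutatorDeriv s r c X (projection M U) ∂(unitaryHaar N) = 0 := by
  have h1 := integral_commutatorDeriv_of_skew M s r c (X := X - X.conjTranspose) (by simp)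
  have h2 := integral_commutatorDeriv_of_skew M s r c
    (X := Complex.I • (X + X.conjTranspose)) (by
      simp [Matrix.conjTranspose_smul, add_comm])
  -- Every matrix is a complex combination of two skew-Hermitian ones, and `commutatorDeriv` is
  -- complex linear in `X`.
  have hX : X = (1 / 2 : ℂ) • (X - X.conjTranspose) +
      (-Complex.I / 2) • (Complex.I • (X + X.conjTranspose)) := by
    ext i j
    simp only [Matrix.add_apply, Matrix.smul_apply, Matrix.sub_apply, smul_eq_mul]
    linear_combination (X i j + X.conjTranspose i j) / 2 * Complex.I_sq
  have hint := fun Y => integrable_of_continuous (continuous_commutatorDeriv M s r c Y)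
  have hP : ∀ P, commutatorDeriv s r c X P =
      (1 / 2 : ℂ) * commutatorDeriv s r c (X - X.conjTranspose) P +
      (-Complex.I / 2) * commutatorDeriv s r c (Complex.I • (X + X.conjTranspose)) P := by
    intro P
    rw [← commutatorDeriv_smul, ← commutatorDeriv_smul, ← commutatorDeriv_add, ← hX]
  simp only [hP]
  rw [integral_add ((hint _).const_mul _) ((hint _).const_mul _), integral_const_mul,
    integral_const_mul, h1, h2]
  simp

/-- The loop equation: infinitesimal invariance under the elementary matrix with entry `(a, b)`. -/
theorem moment_loop_equation (M : ℕ) (s : Finset ι) (r c : ι → Fin N) (a b : Fin N) :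
    ∑ l ∈ s, (if r l = a then moment M s (Function.update r l b) c else 0) =
      ∑ l ∈ s, (if c l = b then moment M s r (Function.update c l a) else 0) := by
  have h := integral_commutatorDeriv M s r c (Matrix.single a b 1)
  have hP : ∀ P : Matrix (Fin N) (Fin N) ℂ, commutatorDeriv s r c (Matrix.single a b 1) P =
      ∑ l ∈ s, (if r l = a then ∏ i ∈ s, P (Function.update r l b i) (c i) else 0) -
      ∑ l ∈ s, (if c l = b then ∏ i ∈ s, P (r i) (Function.update c l a i) else 0) := by
    intro P
    rw [commutatorDeriv, ← Finset.sum_sub_distrib]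
    refine Finset.sum_congr rfl fun l hl => ?_
    rw [← Finset.mul_prod_erase s _ hl, ← Finset.mul_prod_erase s _ hl]
    have e1 : ∏ i ∈ s.erase l, P (Function.update r l b i) (c i) =
        ∏ i ∈ s.erase l, P (r i) (c i) :=
      Finset.prod_congr rfl fun i hi => by rw [Function.update_of_ne (Finset.ne_of_mem_erase hi)]
    have e2 : ∏ i ∈ s.erase l, P (r i) (Function.update c l a i) =
        ∏ i ∈ s.erase l, P (r i) (c i) :=
      Finset.prod_congr rfl fun i hi => by rw [Function.update_of_ne (Finset.ne_of_mem_erase hi)]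
    rw [e1, e2, Function.update_self, Function.update_self, Matrix.sub_apply, mul_sub]
    congr 1
    · split_ifs with hr
      · subst hr
        simp [mul_comm]
      · rw [Matrix.single_mul_apply_of_ne _ _ _ _ _ hr]
        simp
    · split_ifs with hc
      · subst hc
        simp [mul_comm]
      · rw [Matrix.mul_single_apply_of_ne _ _ _ _ _ hc]
        simp
  simp only [hP] at h
  have hI : ∀ (p : Prop) [Decidable p] (r c : ι → Fin N),
      Integrable (fun U => if p then ∏ i ∈ s, projection M U (r i) (c i) else 0)
        (unitaryHaar N) := by
    intro p _ r c
    split_ifs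
    · exact integrable_prod_projection M s r c
    · exact integrable_zero _ _ _
  have hJ : ∀ (p : Prop) [Decidable p] (r c : ι → Fin N),
      ∫ U, (if p then ∏ i ∈ s, projection M U (r i) (c i) else 0) ∂(unitaryHaar N) =
        if p then moment M s r c else 0 := by
    intro p _ r c
    split_ifs
    · rfl
    · simp
  rw [integral_sub (integrable_finsetSum _ fun l _ => hI _ _ _)
    (integrable_finsetSum _ fun l _ => hI _ _ _),
    integral_finsetSum _ fun l _ => hI _ _ _, integral_finsetSum _ fun l _ => hI _ _ _] at h
  simpa only [hJ] using sub_eq_zero.1 h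

end

/-! ### The Weingarten recursion `(N + J_b) W_{b+1} = (M + J_b) W_b`. -/

section
variable {N k : ℕ}

theorem projection_mul_self {M : ℕ} (hMN : M < N) (U : Matrix.unitaryGroup (Fin N) ℂ) :
    projection M U * projection M U = projection M U :=
  (conj_mem_grassmannian hMN U).1

theorem trace_projection {M : ℕ} (hMN : M < N) (U : Matrix.unitaryGroup (Fin N) ℂ) :
    (projection M U).trace = M := by
  have hU : (U : Matrix (Fin N) (Fin N) ℂ).conjTranspose * (U : Matrix (Fin N) (Fin N) ℂ) = 1 :=
    Matrix.mem_unitaryGroup_iff'.1 U.2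
  rw [projection, Matrix.trace_mul_cycle, hU, one_mul, truncatedIdentity, Matrix.trace_diagonal,
    Finset.sum_boole]
  have := Fin.card_filter_val_lt (n := N) (m := M)
  rw [this, min_eq_right hMN.le]

/-- `σ` fixes every point from `m` on. -/
def FixesFrom (m : ℕ) (σ : Equiv.Perm (Fin k)) : Prop := ∀ i : Fin k, m ≤ i → σ i = i

theorem fixesFrom_mul_swap_iff {m : ℕ} {σ : Equiv.Perm (Fin k)} {i j : Fin k} (hi : (i : ℕ) < m)
    (hj : (j : ℕ) < m) : FixesFrom m (σ * Equiv.swap i j) ↔ FixesFrom m σ := by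
  refine forall₂_congr fun x hx => ?_
  rw [Equiv.Perm.mul_apply, Equiv.swap_apply_of_ne_of_ne] <;> (rintro rfl; omega)

theorem fixesFrom_iff_succ {b : Fin k} {σ : Equiv.Perm (Fin k)} :
    FixesFrom b σ ↔ FixesFrom (b + 1) σ ∧ σ b = b := by
  constructor
  · exact fun h => ⟨fun i hi => h i (by omega), h b le_rfl⟩
  · rintro ⟨h, hb⟩ i hi
    rcases eq_or_lt_of_le hi with hi | hi
    · obtain rfl : b = i := Fin.ext hi
      exact hb
    · exact h i hi

theorem FixesFrom.apply_mem_Iic {b : Fin k} {σ : Equiv.Perm (Fin k)} (h : FixesFrom (b + 1) σ)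
    {i : Fin k} (hi : i ≤ b) : σ i ≤ b := by
  by_contra hc
  have h1 := h (σ i) (by have := not_le.1 hc; exact this)
  have := σ.injective h1
  exact hc (this.symm ▸ hi)

theorem FixesFrom.symm_apply_mem_Iic {b : Fin k} {σ : Equiv.Perm (Fin k)}
    (h : FixesFrom (b + 1) σ) {i : Fin k} (hi : i ≤ b) : σ.symm i ≤ b := by
  by_contra hc
  have h1 := h (σ.symm i) (by have := not_le.1 hc; exact this)
  rw [Equiv.apply_symm_apply] at h1
  exact hc (h1 ▸ hi)

/-- The factors commute, so the product can be reindexed by `(l b)`; this moves the transposition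
from the row indices to the column indices. -/
theorem moment_swap_rows (M : ℕ) (e : Fin k → Fin N) (σ : Equiv.Perm (Fin k)) {b l : Fin k}
    (hl : l < b) : moment M (Finset.Iic b) (e ∘ Equiv.swap l b) (e ∘ σ) =
      moment M (Finset.Iic b) e (e ∘ (σ * Equiv.swap l b : Equiv.Perm (Fin k))) := by
  have hmem : ∀ i, i ∈ Finset.Iic b → Equiv.swap l b i ∈ Finset.Iic b := by
    intro i hi
    rw [Finset.mem_Iic] at *
    rw [Equiv.swap_apply_def]
    split_ifs
    · exact le_rfl
    · exact hl.le
    · exact hi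
  refine integral_congr_ae (Filter.Eventually.of_forall fun U => ?_)
  exact Finset.prod_nbij' (Equiv.swap l b) (Equiv.swap l b) hmem hmem (by simp) (by simp) (by simp)

/-- Relabelling the index of `b` by an arbitrary `c` produces one extra term for each collision. -/
theorem moment_update (M : ℕ) {e : Fin k → Fin N} (he : Function.Injective e) {b : Fin k}
    {σ : Equiv.Perm (Fin k)} (hσ : FixesFrom (b + 1) σ) (c : Fin N) :
    moment M (Finset.Iic b) (Function.update e b c) (Function.update e b c ∘ σ) =
      moment M (Finset.Iic b) e (e ∘ σ) + ∑ l ∈ Finset.Iio b, if e l = c then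
        moment M (Finset.Iic b) e (e ∘ (σ * Equiv.swap l b : Equiv.Perm (Fin k))) else 0 := by
  by_cases hc : c = e b
  · subst hc
    rw [Function.update_eq_self, Finset.sum_eq_zero, add_zero]
    intro l hl
    rw [if_neg]
    exact fun h => (Finset.mem_Iio.1 hl).ne (he h)
  -- Only the row index at `b` is relabelled to `c` here. The elementary matrix with entry `(c, e
  -- b)` either relabels the matching column as well or turns a row index `c` back into `e b`.
  have hloop := moment_loop_equation M (Finset.Iic b) (Function.update e b c) (e ∘ σ) c (e b)
  have hcols : ∑ l ∈ Finset.Iic b, (if (e ∘ σ) l = e b then moment M (Finset.Iic b)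
      (Function.update e b c) (Function.update (e ∘ σ) l c) else 0) =
      moment M (Finset.Iic b) (Function.update e b c) (Function.update e b c ∘ σ) := by
    rw [Finset.sum_eq_single (σ.symm b)]
    · rw [if_pos (by simp)]
      congr 1
      funext x
      by_cases hx : x = σ.symm b
      · simp [hx]
      · have : σ x ≠ b := fun h => hx (by simp [← h])
        simp [hx, this]
    · intro l _ hl
      rw [if_neg]
      intro h
      exact hl (by simp [← he h])
    · intro h
      exact absurd (Finset.mem_Iic.2 (hσ.symm_apply_mem_Iic le_rfl)) h
  rw [hcols] at hloop
  -- On the row side, `l = b` undoes the relabelling and gives the main term. A collision `e l = c`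
  -- with `l < b` exchanges the row indices of `l` and `b`.
  rw [← hloop, ← Finset.Iio_insert b, Finset.sum_insert (by simp), Finset.Iio_insert b]
  congr 1
  · simp
  · refine Finset.sum_congr rfl fun l hl => ?_
    have hlb := Finset.mem_Iio.1 hl
    rw [Function.update_of_ne hlb.ne]
    split_ifs with h
    · rw [← moment_swap_rows M e σ hlb]
      congr 1
      funext x
      rw [Function.comp_apply, Equiv.swap_apply_def]
      split_ifs with h1 h2
      · simp [h1]
      · rw [h2, Function.update_of_ne hlb.ne', Function.update_self, h]
      · rw [Function.update_of_ne h1, Function.update_of_ne h2]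
    · rfl

/-- Summing the index of a fixed point produces the trace. -/
theorem sum_moment_update_of_fixed {M : ℕ} (hMN : M < N) {e : Fin k → Fin N} {b : Fin k}
    {σ : Equiv.Perm (Fin k)} (hb : σ b = b) :
    ∑ c, moment M (Finset.Iic b) (Function.update e b c) (Function.update e b c ∘ σ) =
      M * moment M (Finset.Iio b) e (e ∘ σ) := by
  unfold moment
  rw [← integral_finsetSum _ fun c _ => integrable_prod_projection M _ _ _, ← integral_const_mul]
  refine integral_congr_ae (Filter.Eventually.of_forall fun U => ?_)
  simp only [← Finset.Iio_insert b, Finset.prod_insert (Finset.notMem_Iio_self)]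
  have h : ∀ c, ∏ i ∈ Finset.Iio b, projection M U (Function.update e b c i)
      ((Function.update e b c ∘ σ) i) = ∏ i ∈ Finset.Iio b, projection M U (e i) ((e ∘ σ) i) := by
    intro c
    refine Finset.prod_congr rfl fun i hi => ?_
    have hi' := (Finset.mem_Iio.1 hi).ne
    have : σ i ≠ b := fun h => hi' (σ.injective (h.trans hb.symm))
    simp [hi', this]
  simp only [h, ← Finset.sum_mul]
  congr 1
  rw [← trace_projection hMN U, Matrix.trace]
  simp [hb]

/-- Summing the index of a point that is not fixed contracts it, as the projection is idempotent. -/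
theorem sum_moment_update_of_moved {M : ℕ} (hMN : M < N) {e : Fin k → Fin N} {b : Fin k}
    {σ : Equiv.Perm (Fin k)} (hσ : FixesFrom (b + 1) σ) (hb : σ b ≠ b) :
    ∑ c, moment M (Finset.Iic b) (Function.update e b c) (Function.update e b c ∘ σ) =
      moment M (Finset.Iio b) e
        (e ∘ (σ * Equiv.swap (σ.symm b) b : Equiv.Perm (Fin k))) := by
  unfold moment
  rw [← integral_finsetSum _ fun c _ => integrable_prod_projection M _ _ _]
  refine integral_congr_ae (Filter.Eventually.of_forall fun U => ?_)
  have hpb : σ.symm b ≠ b := fun h => hb (by rw [← h, Equiv.apply_symm_apply, h])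
  have hp : σ.symm b ∈ Finset.Iio b :=
    Finset.mem_Iio.2 (lt_of_le_of_ne (hσ.symm_apply_mem_Iic le_rfl) hpb)
  simp only [← Finset.Iio_insert b, Finset.prod_insert (Finset.notMem_Iio_self),
    ← Finset.mul_prod_erase _ _ hp]
  have h : ∀ c, ∏ i ∈ (Finset.Iio b).erase (σ.symm b), projection M U (Function.update e b c i)
      ((Function.update e b c ∘ σ) i) = ∏ i ∈ (Finset.Iio b).erase (σ.symm b),
        projection M U (e i)
          ((e ∘ (σ * Equiv.swap (σ.symm b) b : Equiv.Perm (Fin k))) i) := by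
    intro c
    refine Finset.prod_congr rfl fun i hi => ?_
    obtain ⟨hi1, hi2⟩ := Finset.mem_erase.1 hi
    have hi' := (Finset.mem_Iio.1 hi2).ne
    have : σ i ≠ b := fun h => hi1 (by simp [← h])
    simp [hi', this, Equiv.swap_apply_of_ne_of_ne hi1 hi']
  simp only [h, ← mul_assoc, ← Finset.sum_mul]
  congr 1
  conv_rhs => rw [← projection_mul_self hMN U, Matrix.mul_apply]
  refine Finset.sum_congr rfl fun c _ => ?_
  simp [hb, hpb, mul_comm]

open scoped Classical in
/-- The Weingarten function of permutations of the first `m` points, extended by zero. -/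
noncomputable def prefixWeingarten (M : ℕ) (e : Fin k → Fin N) (m : ℕ)
    (σ : Equiv.Perm (Fin k)) : ℂ :=
  if FixesFrom m σ then moment M {i : Fin k | (i : ℕ) < m} e (e ∘ σ) else 0

/-- Extension by zero lets one identity cover both contractions: at most one term on the right is
nonzero, namely `σ` itself if `σ b = b`, and otherwise `l = σ⁻¹ b`, the only `l` for which `σ (l b)`
fixes `b`. -/
theorem prefixWeingarten_recursion {M : ℕ} (hMN : M < N) {e : Fin k → Fin N}
    (he : Function.Injective e) (b : Fin k) (σ : Equiv.Perm (Fin k)) :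
    N * prefixWeingarten M e (b + 1) σ +
        ∑ l ∈ Finset.Iio b, prefixWeingarten M e (b + 1) (σ * Equiv.swap l b) =
      M * prefixWeingarten M e b σ +
        ∑ l ∈ Finset.Iio b, prefixWeingarten M e b (σ * Equiv.swap l b) := by
  have hIic : ({i : Fin k | (i : ℕ) < b + 1} : Finset (Fin k)) = Finset.Iic b := by
    ext i; simp
  have hIio : ({i : Fin k | (i : ℕ) < b} : Finset (Fin k)) = Finset.Iio b := by
    ext i; simp
  have hswap : ∀ l ∈ Finset.Iio b,
      (FixesFrom (b + 1) (σ * Equiv.swap l b) ↔ FixesFrom (b + 1) σ) := fun l hl =>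
    have hl' : l < b := Finset.mem_Iio.1 hl
    fixesFrom_mul_swap_iff (Nat.lt_succ_of_lt hl') (Nat.lt_succ_self _)
  unfold prefixWeingarten
  rw [hIic, hIio]
  by_cases hσ : FixesFrom (b + 1) σ
  -- Over all `c`, the main term is counted `N` times and each `l < b` collides with exactly one
  -- `c`.
  · have hsum := Finset.sum_congr (rfl : (Finset.univ : Finset (Fin N)) = _)
      fun c _ => moment_update M he hσ c
    rw [Finset.sum_add_distrib, Finset.sum_const, Finset.sum_comm] at hsum
    simp only [Finset.sum_ite_eq, Finset.mem_univ, if_true, Finset.card_univ, Fintype.card_fin,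
      nsmul_eq_mul] at hsum
    rw [if_pos hσ, Finset.sum_congr rfl fun l hl => if_pos ((hswap l hl).2 hσ), ← hsum]
    by_cases hb : σ b = b
    · rw [sum_moment_update_of_fixed hMN hb, if_pos (fixesFrom_iff_succ.2 ⟨hσ, hb⟩),
        Finset.sum_eq_zero, add_zero]
      intro l hl
      rw [if_neg]
      intro h
      have := (fixesFrom_iff_succ.1 h).2
      rw [Equiv.Perm.mul_apply, Equiv.swap_apply_right] at this
      exact (Finset.mem_Iio.1 hl).ne (σ.injective (this.trans hb.symm))
    · have hpb : σ.symm b ≠ b := fun h => hb (by rw [← h, Equiv.apply_symm_apply, h])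
      have hp : σ.symm b ∈ Finset.Iio b :=
        Finset.mem_Iio.2 (lt_of_le_of_ne (hσ.symm_apply_mem_Iic le_rfl) hpb)
      rw [sum_moment_update_of_moved hMN hσ hb, if_neg fun h => hb (fixesFrom_iff_succ.1 h).2,
        mul_zero, zero_add, Finset.sum_eq_single_of_mem _ hp, if_pos]
      · exact fixesFrom_iff_succ.2 ⟨(hswap _ hp).2 hσ, by simp⟩
      · intro l hl hne
        rw [if_neg]
        intro h
        have := (fixesFrom_iff_succ.1 h).2
        rw [Equiv.Perm.mul_apply, Equiv.swap_apply_right] at this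
        exact hne (by simp [← this])
  · have hσ' : ∀ τ, ¬ FixesFrom (b + 1) τ → ¬ FixesFrom (b : ℕ) τ :=
      fun τ h h' => h (fixesFrom_iff_succ.1 h').1
    rw [if_neg hσ, if_neg (hσ' σ hσ), mul_zero, mul_zero]
    congr 1
    refine Finset.sum_congr rfl fun l hl => ?_
    have := fun h => hσ ((hswap l hl).1 h)
    rw [if_neg this, if_neg (hσ' _ this)]

open scoped Classical in
theorem prefixWeingarten_zero (M : ℕ) (e : Fin k → Fin N) (σ : Equiv.Perm (Fin k)) :
    prefixWeingarten M e 0 σ = if σ = 1 then 1 else 0 := by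
  have : FixesFrom 0 σ ↔ σ = 1 := by
    simp [FixesFrom, Equiv.ext_iff]
  simp [prefixWeingarten, this, moment]

theorem weingarten_eq_prefixWeingarten {M : ℕ} (hMN : M < N) (hkN : k ≤ N)
    (σ : Equiv.Perm (Fin k)) :
    weingarten hMN hkN σ = prefixWeingarten M (Fin.castLE hkN) k σ := by
  have h : FixesFrom k σ := fun i hi => absurd i.2 (by omega)
  rw [prefixWeingarten, if_pos h, moment, weingarten, grassmannianMeasure,
    integral_map (measurable_orbitMap hMN).aemeasurable]
  · refine integral_congr_ae (Filter.Eventually.of_forall fun U => ?_)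
    simp [orbitMap, projection]
  · refine Continuous.aestronglyMeasurable ?_
    exact continuous_finsetProd _ fun i _ => continuous_subtype_val.matrix_elem _ _

end

/-! ### Counting monotone factorisations by removing the last transposition. -/

section
variable {k : ℕ}

theorem exists_swap_lt_of_isSwap {s : Equiv.Perm (Fin k)} (hs : s.IsSwap) :
    ∃ x y, x < y ∧ s = Equiv.swap x y := by
  obtain ⟨x, y, hne, rfl⟩ := hs
  rcases hne.lt_or_gt with h | h
  · exact ⟨x, y, h, rfl⟩
  · exact ⟨y, x, h, Equiv.swap_comm _ _⟩

theorem mul_self_of_isSwap {s : Equiv.Perm (Fin k)} (hs : s.IsSwap) : s * s = 1 := by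
  obtain ⟨x, y, -, rfl⟩ := hs
  exact Equiv.swap_mul_self x y

/-- All upper points of the factorisation `τ` are less than `m`. -/
def UpperPointsBelow {r : ℕ} (m : ℕ) (τ : Fin r → Equiv.Perm (Fin k)) : Prop :=
  ∀ i, ∀ y : Fin k, upperPoint (τ i) = y → (y : ℕ) < m

theorem UpperPointsBelow.mono {r m n : ℕ} {τ : Fin r → Equiv.Perm (Fin k)}
    (h : UpperPointsBelow m τ) (hmn : m ≤ n) : UpperPointsBelow n τ :=
  fun i y hy => (h i y hy).trans_le hmn

theorem upperPointsBelow_snoc {r m : ℕ} {τ : Fin r → Equiv.Perm (Fin k)} {s : Equiv.Perm (Fin k)} :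
    UpperPointsBelow m (Fin.snoc τ s : Fin (r + 1) → Equiv.Perm (Fin k)) ↔
      UpperPointsBelow m τ ∧ ∀ y : Fin k, upperPoint s = y → (y : ℕ) < m := by
  constructor
  · intro h
    exact ⟨fun i => by simpa using h i.castSucc, by simpa using h (Fin.last r)⟩
  · rintro ⟨h1, h2⟩ i
    refine Fin.lastCases ?_ (fun j => ?_) i
    · simpa using h2
    · simpa using h1 j

theorem isMonotoneFactorisation_snoc {r : ℕ} {σ : Equiv.Perm (Fin k)}
    {τ : Fin r → Equiv.Perm (Fin k)} {s : Equiv.Perm (Fin k)} :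
    IsMonotoneFactorisation σ (Fin.snoc τ s : Fin (r + 1) → Equiv.Perm (Fin k)) ↔
      s.IsSwap ∧ IsMonotoneFactorisation (σ * s) τ ∧ ∀ i, upperPoint (τ i) ≤ upperPoint s := by
  have hprod : (List.ofFn (Fin.snoc τ s : Fin (r + 1) → Equiv.Perm (Fin k))).prod =
      (List.ofFn τ).prod * s := by
    rw [List.ofFn_succ', List.concat_eq_append, List.prod_append]
    simp
  have hmul : s.IsSwap → ((List.ofFn τ).prod * s = σ ↔ (List.ofFn τ).prod = σ * s) := by
    intro hs
    rw [← mul_left_inj s, mul_assoc, mul_self_of_isSwap hs, mul_one]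
  unfold IsMonotoneFactorisation
  rw [hprod]
  constructor
  · rintro ⟨h1, h2, h3⟩
    have hs : s.IsSwap := by simpa using h1 (Fin.last r)
    refine ⟨hs, ⟨fun i => by simpa using h1 i.castSucc, (hmul hs).1 h2, fun i j hij => ?_⟩,
      fun i => ?_⟩
    · simpa using h3 (Fin.castSucc_le_castSucc_iff.2 hij)
    · simpa using h3 (Fin.le_last i.castSucc)
  · rintro ⟨hs, ⟨h1, h2, h3⟩, h4⟩
    refine ⟨fun i => ?_, (hmul hs).2 h2, fun i j => ?_⟩
    · refine Fin.lastCases ?_ (fun j => ?_) i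
      · simpa using hs
      · simpa using h1 j
    · refine Fin.lastCases ?_ (fun j => ?_) j
      · refine Fin.lastCases ?_ (fun i => ?_) i
        · simp
        · intro _
          simpa using h4 i
      · refine Fin.lastCases ?_ (fun i => ?_) i
        · intro h
          exact absurd h (not_le.2 (Fin.castSucc_lt_last j))
        · intro h
          simpa using h3 (Fin.castSucc_le_castSucc_iff.1 h)

/-- A monotone factorisation with largest upper point `b` ends in a transposition `(l b)`. -/
theorem snoc_largest_upperPoint_iff {r : ℕ} {σ : Equiv.Perm (Fin k)}
    {τ : Fin r → Equiv.Perm (Fin k)} {s : Equiv.Perm (Fin k)} {b : Fin k} :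
    (IsMonotoneFactorisation σ (Fin.snoc τ s : Fin (r + 1) → Equiv.Perm (Fin k)) ∧
      UpperPointsBelow (b + 1) (Fin.snoc τ s : Fin (r + 1) → Equiv.Perm (Fin k))) ∧
      ¬ UpperPointsBelow b (Fin.snoc τ s : Fin (r + 1) → Equiv.Perm (Fin k)) ↔
    (∃ l ∈ Finset.Iio b, Equiv.swap l b = s) ∧
      IsMonotoneFactorisation (σ * s) τ ∧ UpperPointsBelow (b + 1) τ := by
  rw [isMonotoneFactorisation_snoc, upperPointsBelow_snoc, upperPointsBelow_snoc]
  constructor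
  · rintro ⟨⟨⟨hs, hmono, hle⟩, hbelow, hsb⟩, hnot⟩
    refine ⟨?_, hmono, hbelow⟩
    obtain ⟨x, y, hxy, rfl⟩ := exists_swap_lt_of_isSwap hs
    rw [upperPoint_swap hxy] at hle hsb hnot
    have hyb : (y : ℕ) < b + 1 := hsb y rfl
    rcases (Nat.lt_succ_iff.1 hyb).eq_or_lt with h | h
    · obtain rfl : y = b := Fin.ext h
      exact ⟨x, Finset.mem_Iio.2 hxy, rfl⟩
    -- If the last upper point were below `b`, monotonicity would keep all of them below `b`.
    · refine absurd ⟨fun i z hz => ?_, fun z hz => ?_⟩ hnot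
      · have hzy := hle i
        rw [hz, WithBot.coe_le_coe] at hzy
        exact lt_of_le_of_lt hzy h
      · rw [← WithBot.coe_inj.1 hz]
        exact h
  · rintro ⟨⟨l, hl, rfl⟩, hmono, hbelow⟩
    have hlb : l < b := Finset.mem_Iio.1 hl
    rw [upperPoint_swap hlb]
    refine ⟨⟨⟨⟨l, b, hlb.ne, rfl⟩, hmono, fun i => ?_⟩, hbelow, fun y hy => ?_⟩, fun h => ?_⟩
    · obtain ⟨x, y, hxy, hi⟩ := exists_swap_lt_of_isSwap (hmono.1 i)
      have hy : upperPoint (τ i) = y := by rw [hi, upperPoint_swap hxy]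
      rw [hy, WithBot.coe_le_coe]
      exact Nat.lt_succ_iff.1 (hbelow i y hy)
    · rw [← WithBot.coe_inj.1 hy]
      exact Nat.lt_succ_self _
    · exact lt_irrefl _ (h.2 b rfl)

-- Appending `(l b)` creates a new hive exactly when `b` has not yet occurred as an upper point.
open scoped Classical in
theorem hiveNumber_snoc {r : ℕ} {τ : Fin r → Equiv.Perm (Fin k)} {l b : Fin k} (hl : l < b)
    (hτ : UpperPointsBelow (b + 1) τ) :
    hiveNumber (Fin.snoc τ (Equiv.swap l b) : Fin (r + 1) → Equiv.Perm (Fin k)) =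
      hiveNumber τ + if UpperPointsBelow b τ then 1 else 0 := by
  have himage : (Finset.univ.image fun i => upperPoint
      ((Fin.snoc τ (Equiv.swap l b) : Fin (r + 1) → Equiv.Perm (Fin k)) i)) =
      insert (b : WithBot (Fin k)) (Finset.univ.image fun i => upperPoint (τ i)) := by
    ext z
    simp only [Finset.mem_image, Finset.mem_univ, true_and, Finset.mem_insert, Fin.exists_fin_succ',
      Fin.snoc_castSucc, Fin.snoc_last, upperPoint_swap hl]
    rw [or_comm, eq_comm (a := z)]
  have hmem : (b : WithBot (Fin k)) ∈ (Finset.univ.image fun i => upperPoint (τ i)) ↔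
      ¬ UpperPointsBelow b τ := by
    simp only [Finset.mem_image, Finset.mem_univ, true_and, UpperPointsBelow, not_forall]
    constructor
    · rintro ⟨i, hi⟩
      exact ⟨i, b, hi, lt_irrefl _⟩
    · rintro ⟨i, y, hy, hyb⟩
      have := hτ i y hy
      obtain rfl : y = b := Fin.ext (by omega)
      exact ⟨i, hy⟩
  unfold hiveNumber
  rw [himage]
  split_ifs with h
  · rw [Finset.card_insert_of_notMem fun h' => hmem.1 h' h]
  · rw [Finset.insert_eq_of_mem (hmem.2 h), add_zero]

open scoped Classical in
/-- The weighted count of monotone factorisations all of whose upper points are less than `m`. -/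
noncomputable def boundedCount (t : ℂ) (m r : ℕ) (σ : Equiv.Perm (Fin k)) : ℂ :=
  ∑ τ : Fin r → Equiv.Perm (Fin k) with IsMonotoneFactorisation σ τ ∧ UpperPointsBelow m τ,
    t ^ hiveNumber τ

theorem boundedCount_eq_weightedCount (t : ℂ) (r : ℕ) (σ : Equiv.Perm (Fin k)) :
    boundedCount t k r σ = weightedCount t r σ := by
  unfold boundedCount weightedCount
  congr 1
  ext τ
  have : UpperPointsBelow k τ := fun _ y _ => y.2
  simp [this]

open scoped Classical in
theorem boundedCount_zero_right (t : ℂ) (m : ℕ) (σ : Equiv.Perm (Fin k)) :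
    boundedCount t m 0 σ = if σ = 1 then 1 else 0 := by
  unfold boundedCount
  rw [Finset.sum_filter, Fintype.sum_unique]
  simp [IsMonotoneFactorisation, UpperPointsBelow, hiveNumber, eq_comm, Subsingleton.monotone]

theorem boundedCount_zero_succ (t : ℂ) (r : ℕ) (σ : Equiv.Perm (Fin k)) :
    boundedCount t 0 (r + 1) σ = 0 := by
  classical
  unfold boundedCount
  rw [Finset.filter_false_of_mem, Finset.sum_empty]
  rintro τ - ⟨h1, h2⟩
  obtain ⟨x, y, hxy, h⟩ := exists_swap_lt_of_isSwap (h1.1 0)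
  exact Nat.not_lt_zero _ (h2 0 y (by rw [h, upperPoint_swap hxy]))

/-- Removing the last transposition from factorisations with largest upper point `b`. -/
theorem boundedCount_recursion (t : ℂ) (b : Fin k) (r : ℕ) (σ : Equiv.Perm (Fin k)) :
    boundedCount t (b + 1) (r + 1) σ = boundedCount t b (r + 1) σ +
      ∑ l ∈ Finset.Iio b, (boundedCount t (b + 1) r (σ * Equiv.swap l b) -
        (1 - t) * boundedCount t b r (σ * Equiv.swap l b)) := by
  classical
  have hsplit : ∀ (r : ℕ) (σ : Equiv.Perm (Fin k)) (f : (Fin r → Equiv.Perm (Fin k)) → ℂ),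
      ∑ τ with IsMonotoneFactorisation σ τ ∧ UpperPointsBelow (b + 1) τ, f τ =
      ∑ τ with IsMonotoneFactorisation σ τ ∧ UpperPointsBelow b τ, f τ +
      ∑ τ with (IsMonotoneFactorisation σ τ ∧ UpperPointsBelow (b + 1) τ) ∧
        ¬ UpperPointsBelow b τ, f τ := by
    intro r σ f
    rw [← Finset.sum_filter_add_sum_filter_not _ (UpperPointsBelow (b : ℕ)),
      Finset.filter_filter, Finset.filter_filter]
    congr 2
    ext τ
    simp only [Finset.mem_filter, Finset.mem_univ, true_and, and_assoc]
    exact and_congr_right fun _ => ⟨fun h => h.2, fun h => ⟨h.mono (Nat.le_succ _), h⟩⟩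
  -- Subtracting `(1 - t)` times the count without `b` replaces weight 1 by `t` there: the extra `t`
  -- earned when an appended `(l b)` is the first with upper point `b`.
  have hinner : ∀ ρ : Equiv.Perm (Fin k),
      boundedCount t (b + 1) r ρ - (1 - t) * boundedCount t b r ρ =
      ∑ τ : Fin r → Equiv.Perm (Fin k) with
        IsMonotoneFactorisation ρ τ ∧ UpperPointsBelow (b + 1) τ,
        t ^ (hiveNumber τ + if UpperPointsBelow b τ then 1 else 0) := by
    intro ρ
    unfold boundedCount
    rw [hsplit, hsplit r ρ fun τ => t ^ (hiveNumber τ + _)]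
    have h1 : ∑ τ : Fin r → Equiv.Perm (Fin k) with
        IsMonotoneFactorisation ρ τ ∧ UpperPointsBelow b τ,
        t ^ (hiveNumber τ + if UpperPointsBelow b τ then 1 else 0) =
        t * ∑ τ : Fin r → Equiv.Perm (Fin k) with
        IsMonotoneFactorisation ρ τ ∧ UpperPointsBelow b τ, t ^ hiveNumber τ := by
      rw [Finset.mul_sum]
      refine Finset.sum_congr rfl fun τ hτ => ?_
      rw [if_pos (Finset.mem_filter.1 hτ).2.2, pow_succ']
    have h2 : ∑ τ : Fin r → Equiv.Perm (Fin k) with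
        (IsMonotoneFactorisation ρ τ ∧ UpperPointsBelow (b + 1) τ) ∧ ¬ UpperPointsBelow b τ,
        t ^ (hiveNumber τ + if UpperPointsBelow b τ then 1 else 0) =
        ∑ τ : Fin r → Equiv.Perm (Fin k) with
        (IsMonotoneFactorisation ρ τ ∧ UpperPointsBelow (b + 1) τ) ∧ ¬ UpperPointsBelow b τ,
        t ^ hiveNumber τ := by
      refine Finset.sum_congr rfl fun τ hτ => ?_
      rw [if_neg (Finset.mem_filter.1 hτ).2.2, add_zero]
    rw [h1, h2]
    ring
  simp only [hinner]
  unfold boundedCount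
  rw [hsplit (r + 1)]
  congr 1
  -- Each sequence is split into its last entry `s` and the rest; only `s = (l b)` with `l < b`
  -- contributes.
  rw [Finset.sum_filter, ← (Fin.snocEquiv fun _ => Equiv.Perm (Fin k)).sum_comp,
    Fintype.sum_prod_type]
  have hinj : Function.Injective fun l : Fin k => Equiv.swap l b := by
    intro l l' h
    have := congrArg (fun s : Equiv.Perm (Fin k) => s b) h
    simpa using this
  have hsnoc : ∀ (s : Equiv.Perm (Fin k)) (τ : Fin r → Equiv.Perm (Fin k)),
      Fin.snocEquiv (fun _ => Equiv.Perm (Fin k)) (s, τ) =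
        (Fin.snoc τ s : Fin (r + 1) → Equiv.Perm (Fin k)) := fun _ _ => rfl
  simp only [hsnoc, snoc_largest_upperPoint_iff]
  rw [← Finset.sum_image (s := Finset.Iio b) (g := fun l => Equiv.swap l b)
    (f := fun s => ∑ τ : Fin r → Equiv.Perm (Fin k) with
        IsMonotoneFactorisation (σ * s) τ ∧ UpperPointsBelow (b + 1) τ,
        t ^ (hiveNumber τ + if UpperPointsBelow b τ then 1 else 0)) hinj.injOn]
  symm
  refine Finset.sum_subset_zero_on_sdiff (Finset.subset_univ _) (fun s hs => ?_) fun s hs => ?_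
  · refine Finset.sum_eq_zero fun τ _ => if_neg fun h => (Finset.mem_sdiff.1 hs).2 ?_
    exact Finset.mem_image.2 h.1
  · obtain ⟨l, hl, rfl⟩ := Finset.mem_image.1 hs
    rw [Finset.sum_filter]
    refine Finset.sum_congr rfl fun τ _ => ?_
    have hl' : ∃ l' ∈ Finset.Iio b, Equiv.swap l' b = Equiv.swap l b := ⟨l, hl, rfl⟩
    by_cases h : IsMonotoneFactorisation (σ * Equiv.swap l b) τ ∧ UpperPointsBelow (b + 1) τ
    · have h' := And.intro hl' h
      rw [if_pos h, if_pos h', hiveNumber_snoc (Finset.mem_Iio.1 hl) h.2]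
    · rw [if_neg h, if_neg fun h' => h h'.2]

end

/-! ### Convergence, and comparison of the two recursions. -/

section
variable {k : ℕ}

theorem sum_sum_mul_swap (f : Equiv.Perm (Fin k) → ℝ) (b : Fin k) :
    ∑ σ, ∑ l ∈ Finset.Iio b, f (σ * Equiv.swap l b) = b * ∑ σ, f σ := by
  rw [Finset.sum_comm]
  have : ∀ l, ∑ σ, f (σ * Equiv.swap l b) = ∑ σ, f σ := fun l =>
    Equiv.sum_comp (Equiv.mulRight (Equiv.swap l b)) f
  simp [this]

/-- The `ℓ¹` norm of the vector of bounded counts grows at most geometrically. -/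
theorem summable_sum_norm_boundedCount (t : ℂ) {x : ℝ} (hx : 0 ≤ x) {m : ℕ} (hm : m ≤ k)
    (hmx : ∀ b : Fin k, b * x < 1) :
    Summable fun r => (∑ σ : Equiv.Perm (Fin k), ‖boundedCount t m r σ‖) * x ^ r := by
  induction m with
  | zero =>
    refine summable_of_ne_finset_zero (s := {0}) fun r hr => ?_
    obtain ⟨r, rfl⟩ := Nat.exists_eq_succ_of_ne_zero (by simpa using hr)
    simp [boundedCount_zero_succ]
  | succ m ih =>
    have ih := ih (by omega)
    obtain ⟨b, rfl⟩ : ∃ b : Fin k, (b : ℕ) = m := ⟨⟨m, hm⟩, rfl⟩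
    set A : ℕ → ℝ := fun r => ∑ σ : Equiv.Perm (Fin k), ‖boundedCount t (b + 1) r σ‖ with hA
    set B : ℕ → ℝ := fun r => ∑ σ : Equiv.Perm (Fin k), ‖boundedCount t b r σ‖ with hB
    have hA0 : ∀ r, 0 ≤ A r := fun r => Finset.sum_nonneg fun _ _ => norm_nonneg _
    have hB0 : ∀ r, 0 ≤ B r := fun r => Finset.sum_nonneg fun _ _ => norm_nonneg _
    have hrec : ∀ r, A (r + 1) ≤ B (r + 1) + b * (A r + ‖1 - t‖ * B r) := by
      intro r
      have h : ∀ σ : Equiv.Perm (Fin k), ‖boundedCount t (b + 1) (r + 1) σ‖ ≤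
          ‖boundedCount t b (r + 1) σ‖ + ∑ l ∈ Finset.Iio b,
          (fun τ => ‖boundedCount t (b + 1) r τ‖ + ‖1 - t‖ * ‖boundedCount t b r τ‖)
            (σ * Equiv.swap l b) := by
        intro σ
        rw [boundedCount_recursion]
        refine (norm_add_le _ _).trans (add_le_add le_rfl ((norm_sum_le _ _).trans ?_))
        refine Finset.sum_le_sum fun l _ => (norm_sub_le _ _).trans ?_
        rw [norm_mul]
      refine (Finset.sum_le_sum fun σ _ => h σ).trans_eq ?_
      rw [Finset.sum_add_distrib, sum_sum_mul_swap
        (fun τ => ‖boundedCount t (b + 1) r τ‖ + ‖1 - t‖ * ‖boundedCount t b r τ‖), Finset.sum_add_distrib, ← Finset.mul_sum]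
    set S := ∑' r, B r * x ^ r
    have hS : ∀ n, ∑ r ∈ Finset.range n, B r * x ^ r ≤ S := fun n =>
      ih.sum_le_tsum _ fun r _ => mul_nonneg (hB0 r) (pow_nonneg hx r)
    have hbx : 0 ≤ b * x := mul_nonneg (Nat.cast_nonneg _) hx
    -- The bound comes from solving the inequality `hP` below for the partial sum `P`, which is
    -- possible as `b * x < 1`.
    refine summable_of_sum_range_le (c := (A 0 + S + b * x * (‖1 - t‖ * S)) / (1 - b * x))
      (fun r => mul_nonneg (hA0 r) (pow_nonneg hx r)) fun n => ?_
    rw [le_div_iff₀ (sub_pos.2 (hmx b))]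
    set P := ∑ r ∈ Finset.range n, A r * x ^ r
    have hP : P ≤ A 0 + S + b * x * (P + ‖1 - t‖ * S) := by
      -- One more term is added so that, once the term at 0 is split off, the shifted sum matches
      -- `hrec`.
      have h1 : P ≤ ∑ r ∈ Finset.range (n + 1), A r * x ^ r :=
        Finset.sum_le_sum_of_subset_of_nonneg (Finset.range_subset_range.2 (Nat.le_succ n))
          fun r _ _ => mul_nonneg (hA0 r) (pow_nonneg hx r)
      have h2 : ∑ r ∈ Finset.range n, A (r + 1) * x ^ (r + 1) ≤
          ∑ r ∈ Finset.range n, B (r + 1) * x ^ (r + 1) +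
          b * x * (P + ‖1 - t‖ * ∑ r ∈ Finset.range n, B r * x ^ r) := by
        rw [Finset.mul_sum, ← Finset.sum_add_distrib, Finset.mul_sum, ← Finset.sum_add_distrib]
        refine Finset.sum_le_sum fun r _ => ?_
        refine (mul_le_mul_of_nonneg_right (hrec r) (pow_nonneg hx _)).trans_eq ?_
        ring
      have h3 : ∑ r ∈ Finset.range n, B (r + 1) * x ^ (r + 1) ≤ S := by
        refine le_trans ?_ (hS (n + 1))
        rw [Finset.sum_range_succ']
        exact le_add_of_nonneg_right (mul_nonneg (hB0 0) (pow_nonneg hx 0))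
      have h4 : ‖1 - t‖ * ∑ r ∈ Finset.range n, B r * x ^ r ≤ ‖1 - t‖ * S :=
        mul_le_mul_of_nonneg_left (hS n) (norm_nonneg _)
      have h5 := mul_le_mul_of_nonneg_left h4 hbx
      rw [Finset.sum_range_succ'] at h1
      simp only [pow_zero, mul_one] at h1
      linarith
    linarith

theorem summable_boundedCount (t : ℂ) {z : ℂ} (hz : ∀ b : Fin k, b * ‖z‖ < 1) {m : ℕ}
    (hm : m ≤ k) (σ : Equiv.Perm (Fin k)) :
    Summable fun r => boundedCount t m r σ * z ^ r := by
  refine Summable.of_norm_bounded (summable_sum_norm_boundedCount t (norm_nonneg z) hm hz)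
    fun r => ?_
  rw [norm_mul, norm_pow]
  refine mul_le_mul_of_nonneg_right ?_ (pow_nonneg (norm_nonneg z) r)
  exact Finset.single_le_sum (f := fun σ : Equiv.Perm (Fin k) => ‖boundedCount t m r σ‖)
    (fun _ _ => norm_nonneg _) (Finset.mem_univ σ)

open scoped Classical in
theorem tsum_boundedCount_zero (t z : ℂ) (σ : Equiv.Perm (Fin k)) :
    ∑' r, boundedCount t 0 r σ * z ^ r = if σ = 1 then 1 else 0 := by
  rw [tsum_eq_single 0]
  · simp [boundedCount_zero_right]
  · intro r hr
    obtain ⟨r, rfl⟩ := Nat.exists_eq_succ_of_ne_zero hr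
    simp [boundedCount_zero_succ]

/-- This is `(1 - z J_b) F_{b+1} = (1 - (1-t) z J_b) F_b`, summed from the coefficient recursion;
the constant terms of `F_{b+1}` and `F_b` agree. -/
theorem tsum_boundedCount_recursion (t : ℂ) {z : ℂ} (hz : ∀ b : Fin k, b * ‖z‖ < 1)
    (b : Fin k) (σ : Equiv.Perm (Fin k)) :
    ∑' r, boundedCount t (b + 1) r σ * z ^ r = ∑' r, boundedCount t b r σ * z ^ r +
      z * ∑ l ∈ Finset.Iio b, (∑' r, boundedCount t (b + 1) r (σ * Equiv.swap l b) * z ^ r -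
        (1 - t) * ∑' r, boundedCount t b r (σ * Equiv.swap l b) * z ^ r) := by
  have h1 := fun τ => summable_boundedCount t hz (Nat.succ_le_of_lt b.2) τ
  have h0 := fun τ => summable_boundedCount t hz b.2.le τ
  rw [(h1 σ).tsum_eq_zero_add, (h0 σ).tsum_eq_zero_add, boundedCount_zero_right,
    boundedCount_zero_right, add_assoc]
  congr 1
  have hterm : ∀ r, boundedCount t (b + 1) (r + 1) σ * z ^ (r + 1) =
      boundedCount t b (r + 1) σ * z ^ (r + 1) + z * ∑ l ∈ Finset.Iio b,
        (boundedCount t (b + 1) r (σ * Equiv.swap l b) * z ^ r -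
          (1 - t) * (boundedCount t b r (σ * Equiv.swap l b) * z ^ r)) := by
    intro r
    rw [boundedCount_recursion, add_mul, pow_succ', Finset.sum_mul, Finset.mul_sum]
    congr 1
    exact Finset.sum_congr rfl fun l _ => by ring
  have hs : ∀ l, Summable fun r => boundedCount t (b + 1) r (σ * Equiv.swap l b) * z ^ r -
      (1 - t) * (boundedCount t b r (σ * Equiv.swap l b) * z ^ r) :=
    fun l => (h1 _).sub ((h0 _).mul_left _)
  have hsum := summable_sum (s := Finset.Iio b) fun l _ => hs l
  rw [tsum_congr hterm, ((summable_nat_add_iff 1).2 (h0 σ)).tsum_add (hsum.mul_left z),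
    tsum_mul_left, Summable.tsum_finsetSum fun l _ => hs l]
  congr 2
  refine Finset.sum_congr rfl fun l _ => ?_
  rw [(h1 _).tsum_sub ((h0 _).mul_left _), tsum_mul_left]

/-- The operator `1 - z J_b`, with `J_b` a Jucys–Murphy element, is injective for small `z`. -/
theorem eq_zero_of_eq_mul_sum_swap {z : ℂ} {b : Fin k} (hz : b * ‖z‖ < 1)
    {D : Equiv.Perm (Fin k) → ℂ}
    (hD : ∀ σ, D σ = z * ∑ l ∈ Finset.Iio b, D (σ * Equiv.swap l b)) (σ : Equiv.Perm (Fin k)) :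
    D σ = 0 := by
  -- At a maximum of `‖D‖`, the sum of `b` terms gives `‖D τ‖ ≤ b ‖z‖ ‖D τ‖`, which forces `D τ =
  -- 0`.
  obtain ⟨τ, -, hτ⟩ := Finset.exists_max_image Finset.univ (fun σ => ‖D σ‖) ⟨1, Finset.mem_univ _⟩
  have h : ‖D τ‖ ≤ b * ‖z‖ * ‖D τ‖ := by
    calc ‖D τ‖ = ‖z‖ * ‖∑ l ∈ Finset.Iio b, D (τ * Equiv.swap l b)‖ := by
          conv_lhs => rw [hD τ, norm_mul]
      _ ≤ ‖z‖ * ∑ l ∈ Finset.Iio b, ‖D τ‖ := by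
          refine mul_le_mul_of_nonneg_left ((norm_sum_le _ _).trans ?_) (norm_nonneg _)
          exact Finset.sum_le_sum fun l _ => hτ _ (Finset.mem_univ _)
      _ = b * ‖z‖ * ‖D τ‖ := by
          rw [Finset.sum_const, Fin.card_Iio, nsmul_eq_mul]
          ring
  have h0 : ‖D τ‖ = 0 := by
    by_contra hne
    have hpos : 0 < ‖D τ‖ := lt_of_le_of_ne (norm_nonneg _) (Ne.symm hne)
    nlinarith
  exact norm_le_zero_iff.1 (h0 ▸ hτ σ (Finset.mem_univ σ))

theorem prefixWeingarten_eq_tsum {M N : ℕ} (hM : 0 < M) (hMN : M < N)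
    {e : Fin k → Fin N} (he : Function.Injective e) (hz : ∀ b : Fin k, b * ‖-1 / (N : ℂ)‖ < 1)
    {m : ℕ} (hm : m ≤ k) (σ : Equiv.Perm (Fin k)) :
    prefixWeingarten M e m σ =
      ((M : ℂ) / N) ^ m * ∑' r, boundedCount (1 - (N : ℂ) / M) m r σ * (-1 / (N : ℂ)) ^ r := by
  have hM0 : (M : ℂ) ≠ 0 := by exact_mod_cast hM.ne'
  have hN0 : (N : ℂ) ≠ 0 := by exact_mod_cast (hM.trans hMN).ne'
  induction m generalizing σ with
  | zero => rw [prefixWeingarten_zero, tsum_boundedCount_zero, pow_zero, one_mul]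
  | succ m ih =>
    have ih := ih (by omega)
    obtain ⟨b, rfl⟩ : ∃ b : Fin k, (b : ℕ) = m := ⟨⟨m, hm⟩, rfl⟩
    rw [← sub_eq_zero]
    -- By the induction hypothesis the inhomogeneous terms of the two recursions cancel, so the
    -- difference `D` satisfies `D = z J_b D` with `z = -1/N`.
    refine eq_zero_of_eq_mul_sum_swap (hz b) (D := fun σ => prefixWeingarten M e (b + 1) σ -
      ((M : ℂ) / N) ^ ((b : ℕ) + 1) *
        ∑' r, boundedCount (1 - (N : ℂ) / M) (b + 1) r σ * (-1 / (N : ℂ)) ^ r) (fun σ => ?_) σ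
    have hW := prefixWeingarten_recursion hMN he b σ
    have hF := tsum_boundedCount_recursion (1 - (N : ℂ) / M) hz b σ
    simp only [ih, ← Finset.mul_sum] at hW
    rw [Finset.sum_sub_distrib, ← Finset.mul_sum] at hF
    rw [Finset.sum_sub_distrib, ← Finset.mul_sum, hF]
    generalize ∑ l ∈ Finset.Iio b, prefixWeingarten M e (b + 1) (σ * Equiv.swap l b) = W' at *
    generalize prefixWeingarten M e (b + 1) σ = W at *
    generalize ∑ l ∈ Finset.Iio b, ∑' r, boundedCount (1 - (N : ℂ) / M) (b + 1) r
      (σ * Equiv.swap l b) * (-1 / (N : ℂ)) ^ r = F' at *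
    generalize ∑ l ∈ Finset.Iio b, ∑' r, boundedCount (1 - (N : ℂ) / M) b r
      (σ * Equiv.swap l b) * (-1 / (N : ℂ)) ^ r = G' at *
    generalize ∑' r, boundedCount (1 - (N : ℂ) / M) b r σ * (-1 / (N : ℂ)) ^ r = G at *
    have hW2 : W = (M * (((M : ℂ) / N) ^ (b : ℕ) * G) + ((M : ℂ) / N) ^ (b : ℕ) * G' - W') / N := by
      rw [eq_div_iff hN0]
      linear_combination hW
    rw [hW2, pow_succ]
    generalize ((M : ℂ) / N) ^ (b : ℕ) = p
    field_simp
    ring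

end

end GrassmannWeingarten

theorem theorem2 {M N k : ℕ} (hM : 0 < M) (hMN : M < N) (hkN : k ≤ N)
    (σ : Equiv.Perm (Fin k)) (t : ℂ) (ht : t = 1 - (N : ℂ) / (M : ℂ)) :
    Summable (fun r : ℕ => GrassmannWeingarten.weightedCount t r σ * (-1 / (N : ℂ)) ^ r) ∧
      GrassmannWeingarten.weingarten hMN hkN σ =
        1 / (1 - t) ^ k *
          ∑' r : ℕ, GrassmannWeingarten.weightedCount t r σ * (-1 / (N : ℂ)) ^ r := by
  have hz : ∀ b : Fin k, b * ‖-1 / (N : ℂ)‖ < 1 := by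
    intro b
    -- Points are numbered from 0, so even the largest `b` is at most `k - 1 < N`, and convergence
    -- holds up to `k = N`.
    have hb : ((b : ℕ) : ℝ) < N := by exact_mod_cast b.2.trans_le hkN
    have hN : (0 : ℝ) < N := by exact_mod_cast hM.trans hMN
    rw [norm_div, norm_neg, norm_one, Complex.norm_natCast, mul_one_div, div_lt_one hN]
    exact hb
  simp only [← GrassmannWeingarten.boundedCount_eq_weightedCount]
  refine ⟨GrassmannWeingarten.summable_boundedCount t hz le_rfl σ, ?_⟩
  rw [GrassmannWeingarten.weingarten_eq_prefixWeingarten,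
    GrassmannWeingarten.prefixWeingarten_eq_tsum hM hMN (Fin.castLE_injective hkN) hz le_rfl,
    ← ht]
  congr 1
  rw [ht, sub_sub_cancel, one_div, ← inv_pow, inv_div]
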